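/- Let $0<\alpha\le\infty$, let $n\ge 3$, and let $f$ be a real function on $(-\alpha,\alpha)$. For a real matrix $A=[a_{ij}]$ with entries in $(-\alpha,\alpha)$ write $f[A]=[f(a_{ij})]$. For real symmetric matrices, $A\ge B$ means that $A-B$ is positive semidefinite. Assume that $f$ is S-monotone of order $n$, that is, $f[A]\ge f[B]$ for all real symmetric $n\times n$ matrices $A\ge B\ge 0$ with entries in $(-\alpha,\alpha)$. Then $f$ is differentiable on $(-\alpha,\alpha)$, and for all real positive semidefinite $n\times n$ matrices $A=[a_{ij}]$, $B=[b_{ij}]$ with entries in $(-\alpha,\alpha)$, $$s(f[A]-f[B])\prec_w\Bigl(\max_{1\le i\le n}f^{[1]}(a_{ii},b_{ii})\Bigr)\,s(A-B).$$ Here $s(X)=(s_1(X),\dots,s_n(X))$ is the vector of singular values of $X$ in decreasing order, counted with multiplicity; $f^{[1]}(a,b)=\frac{f(a)-f(b)}{a-b}$ if $a\ne b$ and $f^{[1]}(a,a)=f'(a)$; and $\mathbf a\prec_w\mathbf b$ means that $\sum_{i=1}^k a_{[i]}\le\sum_{i=1}^k b_{[i]}$ for $1\le k\le n$, where $a_{[1]}\ge\dots\ge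 a_{[n]}$ is the decreasing rearrangement of the coordinates of $\mathbf a$, and similarly for $\mathbf b$. -/

import Mathlib

/-- The open interval `(-α, α)` of real numbers, where `α` may be `+∞`. -/
def symmInterval (α : EReal) : Set ℝ :=
  {x : ℝ | -α < (x : EReal) ∧ (x : EReal) < α}

/-- `f` is S-monotone (Schur monotone) of order `n` on `(-α, α)`: for all real symmetric
`n × n` matrices `A ≥ B ≥ 0` with entries in `(-α, α)` one has `f[A] ≥ f[B]`, where
`f[A] = A.map f` is the entrywise image and `≥` is the order of positive semidefiniteness
(`Matrix.PosSemidef` includes symmetry). -/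
def SMonotone (n : ℕ) (α : EReal) (f : ℝ → ℝ) : Prop :=
  ∀ A B : Matrix (Fin n) (Fin n) ℝ,
    (∀ i j, A i j ∈ symmInterval α) → (∀ i j, B i j ∈ symmInterval α) →
    (A - B).PosSemidef → B.PosSemidef → (A.map f - B.map f).PosSemidef

/-- The decreasing rearrangement `(a_[1], …, a_[n])` of a real vector. -/
noncomputable def decreasingRearrangement {n : ℕ} (a : Fin n → ℝ) : Fin n → ℝ :=
  a ∘ Tuple.sort (fun i => -a i)

/-- Weak majorization `a ≺_w b`. With zero-based indices, `Finset.Iic k` is the set of the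
first `k + 1` indices. -/
def WeakMajorized {n : ℕ} (a b : Fin n → ℝ) : Prop :=
  ∀ k : Fin n, ∑ i ∈ Finset.Iic k, decreasingRearrangement a i ≤
    ∑ i ∈ Finset.Iic k, decreasingRearrangement b i

/-- The singular values `s_1(M) ≥ … ≥ s_n(M)` of a real `n × n` matrix, with multiplicity. -/
noncomputable def singVals {n : ℕ} (M : Matrix (Fin n) (Fin n) ℝ) : Fin n → ℝ :=
  fun i => M.toEuclideanLin.singularValues i

/-- The divided difference `f^{[1]}(a, b)`; to be used for `f` differentiable at `a`. -/
noncomputable def dividedDifference (f : ℝ → ℝ) (a b : ℝ) : ℝ :=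
  if a = b then deriv f a else (f a - f b) / (a - b)

/-! Since f(a) - f(b) = f^{[1]}(a,b)(a - b), the matrix f[A] - f[B] is the Schur product of P =
[f^{[1]}(a_ij, b_ij)] with A - B. If P is positive semidefinite, P = GᵀG writes this product as ∑
D_l (A - B) D_l with D_l diagonal and ∑ D_l² = diag P, and a Ky Fan estimate concludes
(`sum_singVals_hadamard_le`).

P is positive semidefinite because it is morally the integral of f'[(1-t)B + tA] over [0,1], and f'
preserves positivity: f'[A] is the limit of (f[A + tJ] - f[A])/t, where J is the all-ones matrix.

Differentiability comes first. On the nonnegative part f is monotone, so it is differentiable at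
some β > |x|; a 3×3 Cauchy–Schwarz inequality (`SMonotone.sq_slope_sub_slope_le`) then makes the
slopes at x Cauchy. -/

/-! ### Singular values and a Ky Fan inequality. -/

/-- Bessel's inequality for orthogonal vectors of norm at most one. -/
theorem sum_inner_sq_le_of_orthogonal {E : Type*} [NormedAddCommGroup E] [InnerProductSpace ℝ E]
    {n : ℕ} (u : Fin n → E) (horth : ∀ i j, i ≠ j → inner ℝ (u i) (u j) = 0)
    (hnorm : ∀ i, inner ℝ (u i) (u i) ≤ 1) (s : Finset (Fin n)) (z : E) :
    ∑ i ∈ s, inner ℝ (u i) z ^ 2 ≤ inner ℝ z z := by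
  set w : E := ∑ i ∈ s, inner ℝ (u i) z • u i with hw
  have hzw : inner ℝ z w = ∑ i ∈ s, inner ℝ (u i) z ^ 2 := by
    rw [hw, inner_sum]
    refine Finset.sum_congr rfl fun i _ => ?_
    rw [inner_smul_right, real_inner_comm, sq]
  have hww : inner ℝ w w ≤ ∑ i ∈ s, inner ℝ (u i) z ^ 2 := by
    conv_lhs => rw [hw]
    rw [inner_sum]
    refine Finset.sum_le_sum fun i hi => ?_
    rw [inner_smul_right, sum_inner, Finset.sum_eq_single_of_mem i hi]
    · rw [inner_smul_left]
      simp only [conj_trivial]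
      nlinarith [hnorm i, sq_nonneg (inner ℝ (u i) z : ℝ)]
    · intro j _ hj
      rw [inner_smul_left, horth j i hj, mul_zero]
  have h0 : 0 ≤ inner ℝ (z - w) (z - w) := real_inner_self_nonneg
  rw [inner_sub_left, inner_sub_right, inner_sub_right, real_inner_comm z w, hzw] at h0
  linarith

/-- A singular value decomposition, in which the left vectors belonging to the singular value `0`
are allowed to vanish. -/
theorem LinearMap.exists_singularValueDecomposition {E : Type*} [NormedAddCommGroup E]
    [InnerProductSpace ℝ E] [FiniteDimensional ℝ E] {n : ℕ} (hn : Module.finrank ℝ E = n)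
    (T : E →ₗ[ℝ] E) :
    ∃ (v : OrthonormalBasis (Fin n) ℝ E) (u : Fin n → E),
      (∀ i, T (v i) = T.singularValues i • u i) ∧
      (∀ i, inner ℝ (u i) (T (v i)) = T.singularValues i) ∧
      (∀ i, inner ℝ (u i) (u i) ≤ 1) ∧
      (∀ (s : Finset (Fin n)) (z : E), ∑ i ∈ s, inner ℝ (u i) z ^ 2 ≤ inner ℝ z z) := by
  have hS := T.isSymmetric_adjoint_comp_self
  set v := hS.eigenvectorBasis hn with hv
  have hTT : ∀ i j, inner ℝ (T (v i)) (T (v j)) =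
      if i = j then T.singularValues i ^ 2 else 0 := by
    intro i j
    have h1 := hS.apply_eigenvectorBasis hn j
    rw [← LinearMap.adjoint_inner_right]
    have h2 : (LinearMap.adjoint T) (T (v j)) = (hS.eigenvalues hn j) • v j := h1
    rw [h2, inner_smul_right, orthonormal_iff_ite.mp v.orthonormal, T.sq_singularValues_fin hn]
    split_ifs with h
    · rw [h]; simp
    · simp
  have horth : ∀ i j : Fin n, i ≠ j → inner ℝ ((T.singularValues i)⁻¹ • T (v i))
      ((T.singularValues j)⁻¹ • T (v j)) = 0 := by
    intro i j hij
    rw [inner_smul_left, inner_smul_right, hTT, if_neg hij]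
    simp
  have hnorm : ∀ i : Fin n, inner ℝ ((T.singularValues i)⁻¹ • T (v i))
      ((T.singularValues i)⁻¹ • T (v i)) ≤ 1 := by
    intro i
    rw [inner_smul_left, inner_smul_right, hTT, if_pos rfl]
    rcases eq_or_ne (T.singularValues i) 0 with h | h
    · simp [h]
    · apply le_of_eq
      simp only [conj_trivial]
      field_simp
  -- For a zero singular value the convention `0⁻¹ = 0` makes the left vector vanish.
  refine ⟨v, fun i => (T.singularValues i)⁻¹ • T (v i), fun i => ?_, fun i => ?_, hnorm,
    fun s z => sum_inner_sq_le_of_orthogonal _ horth hnorm s z⟩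
  · rcases eq_or_ne (T.singularValues i) 0 with h | h
    · have h0 := hTT i i
      rw [if_pos rfl, h] at h0
      have : T (v i) = 0 := by
        rw [← inner_self_eq_zero (𝕜 := ℝ)]
        simpa using h0
      simp [this]
    · rw [smul_smul, mul_inv_cancel₀ h, one_smul]
  · rw [inner_smul_left, hTT, if_pos rfl]
    rcases eq_or_ne (T.singularValues i) 0 with h | h
    · simp [h]
    · simp only [conj_trivial]
      field_simp

/-- Moving weight to the first indices, up to the cap m on each, can only increase the sum: s i - s
k and c i minus the capped weight have opposite signs. -/
theorem sum_mul_le_of_antitone {n : ℕ} (s c : Fin n → ℝ) (hs : Antitone s) (hs0 : ∀ i, 0 ≤ s i)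
    {m : ℝ} (hc0 : ∀ i, 0 ≤ c i) (hcm : ∀ i, c i ≤ m) (k : Fin n)
    (hsum : ∑ i, c i ≤ m * (Finset.Iic k).card) :
    ∑ i, s i * c i ≤ m * ∑ i ∈ Finset.Iic k, s i := by
  have hterm : ∀ i, s i * (c i - if i ∈ Finset.Iic k then m else 0) ≤
      s k * (c i - if i ∈ Finset.Iic k then m else 0) := by
    intro i
    split_ifs with h
    · exact mul_le_mul_of_nonpos_right (hs (Finset.mem_Iic.mp h)) (by linarith [hcm i])
    · rw [Finset.mem_Iic, not_le] at h
      exact mul_le_mul_of_nonneg_right (hs h.le) (by linarith [hc0 i])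
  have h := Finset.sum_le_sum fun i (_ : i ∈ Finset.univ) => hterm i
  simp only [mul_sub, Finset.sum_sub_distrib, mul_ite, mul_zero, Finset.sum_ite_mem,
    Finset.univ_inter, ← Finset.mul_sum, ← Finset.sum_mul, Finset.sum_const, nsmul_eq_mul] at h
  have := mul_le_mul_of_nonneg_left hsum (hs0 k)
  nlinarith

/-- Ky Fan norm inequality for a sum of compressions `∑ l, D l ∘ X ∘ D l` by self-adjoint maps with
`∑ l, D l ^ 2 ≤ m`. -/
theorem sum_singularValues_le_of_eq_sum_compressions {E : Type*} [NormedAddCommGroup E]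
    [InnerProductSpace ℝ E] [FiniteDimensional ℝ E] {n : ℕ} (hn : Module.finrank ℝ E = n)
    {ι : Type*} [Fintype ι] (X Y : E →ₗ[ℝ] E) (D : ι → E →ₗ[ℝ] E)
    (hD : ∀ l x y, inner ℝ (D l x) y = inner ℝ x (D l y))
    {m : ℝ} (hm0 : 0 ≤ m) (hm : ∀ z, ∑ l, inner ℝ (D l z) (D l z) ≤ m * inner ℝ z z)
    (hY : ∀ z, Y z = ∑ l, D l (X (D l z))) (k : Fin n) :
    ∑ i ∈ Finset.Iic k, Y.singularValues i ≤ m * ∑ i ∈ Finset.Iic k, X.singularValues i := by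
  obtain ⟨v, u, -, huv, hu1, hu⟩ := Y.exists_singularValueDecomposition hn
  obtain ⟨y, x, hyx, -, hx1, hx⟩ := X.exists_singularValueDecomposition hn
  have hv : ∀ (s : Finset (Fin n)) (z : E), ∑ i ∈ s, inner ℝ (v i) z ^ 2 ≤ inner ℝ z z :=
    fun s z => sum_inner_sq_le_of_orthogonal v (fun i j h => v.orthonormal.2 h)
      (fun i => by simp [v.orthonormal.1 i]) s z
  have hy : ∀ (s : Finset (Fin n)) (z : E), ∑ i ∈ s, inner ℝ (y i) z ^ 2 ≤ inner ℝ z z :=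
    fun s z => sum_inner_sq_le_of_orthogonal y (fun i j h => y.orthonormal.2 h)
      (fun i => by simp [y.orthonormal.1 i]) s z
  have hmz : ∀ z : E, inner ℝ z z ≤ 1 → ∑ l, inner ℝ (D l z) (D l z) ≤ m := fun z hz =>
    (hm z).trans (by nlinarith)
  -- By AM–GM, c j bounds the total coefficient of the j-th singular value of X. Bessel over i gives
  -- c j ≤ m; Bessel over j bounds the total by m times the number of indices in `Finset.Iic k`.
  set c : Fin n → ℝ := fun j => ∑ i ∈ Finset.Iic k, ∑ l,
    (inner ℝ (y j) (D l (v i)) ^ 2 + inner ℝ (x j) (D l (u i)) ^ 2) / 2 with hc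
  have hX : ∀ z, X z = ∑ j, (inner ℝ (y j) z * X.singularValues j) • x j := by
    intro z
    conv_lhs => rw [← y.sum_repr' z]
    simp [map_sum, hyx, smul_smul]
  have hle : ∑ i ∈ Finset.Iic k, Y.singularValues i ≤ ∑ j : Fin n, X.singularValues j * c j := by
    have h1 : ∀ i : Fin n, Y.singularValues i = ∑ j : Fin n, ∑ l, X.singularValues j *
        (inner ℝ (y j) (D l (v i)) * inner ℝ (x j) (D l (u i))) := by
      intro i
      rw [← huv i, hY, inner_sum, Finset.sum_comm]
      refine Finset.sum_congr rfl fun l _ => ?_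
      rw [← hD, hX, inner_sum]
      refine Finset.sum_congr rfl fun j _ => ?_
      rw [inner_smul_right, real_inner_comm (x j)]
      ring
    simp only [h1, hc, Finset.mul_sum]
    rw [Finset.sum_comm]
    refine Finset.sum_le_sum fun j _ => Finset.sum_le_sum fun i _ => Finset.sum_le_sum fun l _ => ?_
    refine mul_le_mul_of_nonneg_left ?_ (X.singularValues_nonneg j)
    linarith [two_mul_le_add_sq (inner ℝ (y j) (D l (v i)) : ℝ) (inner ℝ (x j) (D l (u i)))]
  refine hle.trans (sum_mul_le_of_antitone (fun j : Fin n => X.singularValues j) c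
    (fun i j hij => X.singularValues_antitone hij) (fun j => X.singularValues_nonneg j)
    (fun j => ?_) (fun j => ?_) k ?_)
  · exact Finset.sum_nonneg fun i _ => Finset.sum_nonneg fun l _ => by positivity
  · have e : c j = (∑ l, ∑ i ∈ Finset.Iic k, inner ℝ (v i) (D l (y j)) ^ 2 +
        ∑ l, ∑ i ∈ Finset.Iic k, inner ℝ (u i) (D l (x j)) ^ 2) / 2 := by
      rw [hc, ← Finset.sum_add_distrib, Finset.sum_div]
      dsimp only
      rw [Finset.sum_comm]
      refine Finset.sum_congr rfl fun l _ => ?_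
      rw [← Finset.sum_add_distrib, Finset.sum_div]
      refine Finset.sum_congr rfl fun i _ => ?_
      rw [← hD, ← hD, real_inner_comm (v i), real_inner_comm (u i)]
    have h1 := (Finset.sum_le_sum fun l (_ : l ∈ Finset.univ) => hv (Finset.Iic k) (D l (y j))).trans
      (hmz (y j) (by simp [y.orthonormal.1 j]))
    have h2 := (Finset.sum_le_sum fun l (_ : l ∈ Finset.univ) => hu (Finset.Iic k) (D l (x j))).trans
      (hmz (x j) (hx1 j))
    linarith
  · have e : ∑ j, c j = ∑ i ∈ Finset.Iic k, (∑ l, ∑ j, inner ℝ (y j) (D l (v i)) ^ 2 +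
        ∑ l, ∑ j, inner ℝ (x j) (D l (u i)) ^ 2) / 2 := by
      rw [hc, Finset.sum_comm]
      refine Finset.sum_congr rfl fun i _ => ?_
      rw [Finset.sum_comm, ← Finset.sum_add_distrib, Finset.sum_div]
      refine Finset.sum_congr rfl fun l _ => ?_
      rw [← Finset.sum_add_distrib, Finset.sum_div]
    rw [e, mul_comm, ← nsmul_eq_mul]
    refine Finset.sum_le_card_nsmul _ _ _ fun i _ => ?_
    have h1 := (Finset.sum_le_sum fun l (_ : l ∈ Finset.univ) =>
      hy Finset.univ (D l (v i))).trans (hmz (v i) (by simp [v.orthonormal.1 i]))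
    have h2 := (Finset.sum_le_sum fun l (_ : l ∈ Finset.univ) =>
      hx Finset.univ (D l (u i))).trans (hmz (u i) (hu1 i))
    linarith

/-! ### Schur products with a positive semidefinite matrix. -/

open scoped MatrixOrder in
theorem Matrix.PosSemidef.exists_eq_transpose_mul_self {n : ℕ} {P : Matrix (Fin n) (Fin n) ℝ}
    (hP : P.PosSemidef) : ∃ G : Matrix (Fin n) (Fin n) ℝ, P = G.transpose * G := by
  obtain ⟨G, hG⟩ := CStarAlgebra.nonneg_iff_eq_star_mul_self.mp (Matrix.nonneg_iff_posSemidef.mpr hP)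
  exact ⟨G, by rw [hG, Matrix.star_eq_conjTranspose, Matrix.conjTranspose_eq_transpose_of_trivial]⟩

theorem sum_singVals_hadamard_le {n : ℕ} {P : Matrix (Fin n) (Fin n) ℝ} (hP : P.PosSemidef)
    (X : Matrix (Fin n) (Fin n) ℝ) {m : ℝ} (hm0 : 0 ≤ m) (hm : ∀ i, P i i ≤ m) (k : Fin n) :
    ∑ i ∈ Finset.Iic k, singVals (P.hadamard X) i ≤ m * ∑ i ∈ Finset.Iic k, singVals X i := by
  obtain ⟨G, hG⟩ := hP.exists_eq_transpose_mul_self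
  have hPG : ∀ i j, P i j = ∑ l, G l i * G l j := fun i j => by
    rw [hG, Matrix.mul_apply]; rfl
  refine sum_singularValues_le_of_eq_sum_compressions (by simp) X.toEuclideanLin
    (P.hadamard X).toEuclideanLin (fun l => (Matrix.diagonal (G l)).toEuclideanLin)
    (fun l x y => ?_) hm0 (fun z => ?_) (fun z => ?_) k
  · simp only [EuclideanSpace.inner_eq_star_dotProduct, Matrix.ofLp_toLpLin, Matrix.toLin'_apply,
      dotProduct, Matrix.mulVec_diagonal, Pi.star_apply, star_trivial]
    exact Finset.sum_congr rfl fun i _ => by ring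
  · simp only [EuclideanSpace.inner_eq_star_dotProduct, Matrix.ofLp_toLpLin, Matrix.toLin'_apply,
      dotProduct, Matrix.mulVec_diagonal, Pi.star_apply, star_trivial]
    rw [Finset.sum_comm, Finset.mul_sum]
    refine Finset.sum_le_sum fun i _ => ?_
    have := mul_le_mul_of_nonneg_right (hm i) (mul_self_nonneg (z i))
    rw [hPG, Finset.sum_mul] at this
    refine le_trans (le_of_eq (Finset.sum_congr rfl fun l _ => ?_)) this
    ring
  · have hdiag : ∀ l, (Matrix.diagonal (G l)).mulVec z.ofLp = fun a => G l a * z a := fun l =>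
      funext fun a => Matrix.mulVec_diagonal _ _ _
    ext i
    simp only [WithLp.ofLp_sum, Finset.sum_apply, Matrix.ofLp_toLpLin, Matrix.toLin'_apply,
      Matrix.mulVec_diagonal, hdiag]
    simp only [Matrix.mulVec, dotProduct, Matrix.hadamard_apply, hPG, Finset.mul_sum,
      Finset.sum_mul]
    rw [Finset.sum_comm]
    exact Finset.sum_congr rfl fun l _ => Finset.sum_congr rfl fun j _ => by ring

theorem decreasingRearrangement_of_antitone {n : ℕ} {a : Fin n → ℝ} (ha : Antitone a) :
    decreasingRearrangement a = a := by
  have : Monotone fun i => -a i := fun i j hij => neg_le_neg (ha hij)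
  rw [decreasingRearrangement, Tuple.sort_eq_refl_iff_monotone.mpr this]
  rfl

theorem singVals_antitone {n : ℕ} (M : Matrix (Fin n) (Fin n) ℝ) : Antitone (singVals M) :=
  fun _ _ hij => M.toEuclideanLin.singularValues_antitone hij

/-! ### The interval and quadratic forms. -/

theorem mem_symmInterval_iff {α : EReal} {x : ℝ} :
    x ∈ symmInterval α ↔ ((|x| : ℝ) : EReal) < α := by
  have h : -α < (x : EReal) ↔ ((-x : ℝ) : EReal) < α := by
    rw [EReal.coe_neg, EReal.neg_lt_comm]
  rw [symmInterval, Set.mem_ofPred_eq, h]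
  rcases abs_cases x with ⟨e, hx⟩ | ⟨e, hx⟩ <;> rw [e]
  · refine ⟨fun h => h.2, fun h => ⟨lt_of_le_of_lt ?_ h, h⟩⟩
    exact EReal.coe_le_coe_iff.mpr (by linarith)
  · refine ⟨fun h => h.1, fun h => ⟨h, lt_of_le_of_lt ?_ h⟩⟩
    exact EReal.coe_le_coe_iff.mpr (by linarith)

theorem mem_symmInterval_of_abs_le {α : EReal} {x y : ℝ} (hy : y ∈ symmInterval α)
    (h : |x| ≤ |y|) : x ∈ symmInterval α := by
  rw [mem_symmInterval_iff] at hy ⊢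
  exact lt_of_le_of_lt (EReal.coe_le_coe_iff.mpr h) hy

theorem exists_abs_lt_mem_symmInterval {α : EReal} {x : ℝ} (hx : x ∈ symmInterval α) :
    ∃ c, |x| < c ∧ c ∈ symmInterval α := by
  obtain ⟨c, h1, h2⟩ := EReal.lt_iff_exists_real_btwn.mp (mem_symmInterval_iff.mp hx)
  have hc : |x| < c := EReal.coe_lt_coe_iff.mp h1
  refine ⟨c, hc, mem_symmInterval_iff.mpr ?_⟩
  rwa [abs_of_pos ((abs_nonneg x).trans_lt hc)]

theorem convex_symmInterval (α : EReal) : Convex ℝ (symmInterval α) := by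
  refine Set.OrdConnected.convex ⟨fun x hx y hy z hz => ⟨hx.1.trans_le ?_, lt_of_le_of_lt ?_ hy.2⟩⟩
  · exact EReal.coe_le_coe_iff.mpr hz.1
  · exact EReal.coe_le_coe_iff.mpr hz.2

theorem isOpen_symmInterval (α : EReal) : IsOpen (symmInterval α) := by
  have : symmInterval α = (fun x : ℝ => (x : EReal)) ⁻¹' Set.Ioo (-α) α := rfl
  rw [this]
  exact isOpen_Ioo.preimage continuous_coe_real_ereal

theorem Matrix.star_dotProduct_mulVec_eq_sum {n : ℕ} (M : Matrix (Fin n) (Fin n) ℝ)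
    (v : Fin n → ℝ) : star v ⬝ᵥ M.mulVec v = ∑ i, ∑ j, v i * v j * M i j := by
  simp only [dotProduct, Matrix.mulVec, Pi.star_apply, star_trivial, Finset.mul_sum]
  exact Finset.sum_congr rfl fun i _ => Finset.sum_congr rfl fun j _ => by ring

theorem Matrix.posSemidef_of_sum_nonneg {n : ℕ} {M : Matrix (Fin n) (Fin n) ℝ}
    (hs : ∀ i j, M i j = M j i) (h : ∀ v : Fin n → ℝ, 0 ≤ ∑ i, ∑ j, v i * v j * M i j) :
    M.PosSemidef :=
  .of_dotProduct_mulVec_nonneg (Matrix.ext fun i j => by simpa using hs j i) fun v =>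
    (M.star_dotProduct_mulVec_eq_sum v).symm ▸ h v

theorem Matrix.PosSemidef.sum_nonneg {n : ℕ} {M : Matrix (Fin n) (Fin n) ℝ} (hM : M.PosSemidef)
    (v : Fin n → ℝ) : 0 ≤ ∑ i, ∑ j, v i * v j * M i j :=
  M.star_dotProduct_mulVec_eq_sum v ▸ hM.dotProduct_mulVec_nonneg v

theorem Matrix.PosSemidef.apply_comm {n : ℕ} {M : Matrix (Fin n) (Fin n) ℝ} (hM : M.PosSemidef)
    (i j : Fin n) : M i j = M j i := by
  simpa using hM.isHermitian.apply j i

theorem Matrix.posSemidef_const {n : ℕ} {c : ℝ} (hc : 0 ≤ c) :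
    (Matrix.of fun _ _ => c : Matrix (Fin n) (Fin n) ℝ).PosSemidef := by
  refine posSemidef_of_sum_nonneg (fun _ _ => rfl) fun v => ?_
  have : ∑ i, ∑ j, v i * v j * (Matrix.of fun _ _ => c : Matrix (Fin n) (Fin n) ℝ) i j =
      (∑ i, v i) * (∑ i, v i) * c := by
    rw [Finset.sum_mul_sum]
    simp only [Matrix.of_apply, Finset.sum_mul]
  rw [this]
  exact mul_nonneg (mul_self_nonneg _) hc

/-! ### Differentiability of S-monotone functions. -/

theorem SMonotone.of_le {m n : ℕ} (hm : 0 < m) (hmn : m ≤ n) {α : EReal} {f : ℝ → ℝ}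
    (hf : SMonotone n α f) : SMonotone m α f := by
  intro A B hA hB hAB hB0
  -- Repeating the last row and column enlarges a matrix to order n without new entries, so no value
  -- f(0) intervenes.
  let p : Fin n → Fin m := fun i => ⟨min i (m - 1), by omega⟩
  have h := hf (A.submatrix p p) (B.submatrix p p) (fun _ _ => hA _ _) (fun _ _ => hB _ _)
    (hAB.submatrix p) (hB0.submatrix p)
  have hq : ∀ i : Fin m, p (Fin.castLE hmn i) = i := fun i => Fin.ext (by simp [p]; omega)
  convert h.submatrix (Fin.castLE hmn) using 1
  ext i j
  simp [hq]

theorem SMonotone.monotoneOn {n : ℕ} (hn : 0 < n) {α : EReal} {f : ℝ → ℝ}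
    (hf : SMonotone n α f) : MonotoneOn f (symmInterval α ∩ Set.Ici 0) := by
  intro b hb a ha hab
  have h := hf (.of fun _ _ => a) (.of fun _ _ => b) (fun _ _ => ha.1) (fun _ _ => hb.1)
    (Matrix.posSemidef_const (sub_nonneg.mpr hab))
    (Matrix.posSemidef_const hb.2)
  simpa using h.diag_nonneg (i := ⟨0, hn⟩)

theorem SMonotone.exists_differentiableAt {n : ℕ} (hn : 0 < n) {α : EReal} {f : ℝ → ℝ}
    (hf : SMonotone n α f) {x : ℝ} (hx : x ∈ symmInterval α) :
    ∃ β, |x| < β ∧ β ∈ symmInterval α ∧ DifferentiableAt ℝ f β := by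
  obtain ⟨c, hc, hcα⟩ := exists_abs_lt_mem_symmInterval hx
  have hsub : Set.Ioo |x| c ⊆ symmInterval α ∩ Set.Ici 0 := fun y hy => by
    have hy0 : 0 < y := (abs_nonneg x).trans_lt hy.1
    refine ⟨mem_symmInterval_of_abs_le hcα ?_, hy0.le⟩
    rw [abs_of_pos hy0, abs_of_pos (hy0.trans hy.2)]
    exact hy.2.le
  have hae := ((hf.monotoneOn hn).mono hsub).ae_differentiableWithinAt_of_mem
  have hpos : MeasureTheory.volume (Set.Ioo |x| c) ≠ 0 := by simp [hc]
  obtain ⟨β, hβ, hd⟩ := MeasureTheory.Measure.exists_mem_of_measure_ne_zero_of_ae hpos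
    (MeasureTheory.ae_restrict_of_ae hae)
  exact ⟨β, hβ.1, (hsub hβ).1, (hd hβ).differentiableAt (isOpen_Ioo.mem_nhds hβ)⟩

/-- Cauchy–Schwarz for the form M and the vectors (a, -b, 0) and (0, 0, 1). -/
theorem Matrix.PosSemidef.sq_sub_le {M : Matrix (Fin 3) (Fin 3) ℝ} (hM : M.PosSemidef) (a b : ℝ) :
    (a * M 0 2 - b * M 1 2) ^ 2 ≤
      (a ^ 2 * M 0 0 + b ^ 2 * M 1 1 - 2 * a * b * M 0 1) * M 2 2 := by
  have h : ∀ t : ℝ, 0 ≤ M 2 2 * (t * t) + (2 * (a * M 0 2 - b * M 1 2)) * t +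
      (a ^ 2 * M 0 0 + b ^ 2 * M 1 1 - 2 * a * b * M 0 1) := fun t => by
    have h := hM.sum_nonneg ![a, -b, t]
    simp only [Fin.sum_univ_three, Matrix.cons_val_zero, Matrix.cons_val_one, Matrix.cons_val] at h
    rw [hM.apply_comm 1 0, hM.apply_comm 2 0, hM.apply_comm 2 1] at h
    linarith
  have := discrim_le_zero h
  rw [discrim] at this
  linarith

/-- Comparison of difference quotients at `x` with those at a point `β ≥ |x|`. -/
theorem SMonotone.sq_slope_sub_slope_le {α : EReal} {f : ℝ → ℝ} (hf : SMonotone 3 α f)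
    {x β δ h k : ℝ} (hxβ : |x| ≤ β) (hδ : 0 < δ) (hβ : β + δ ∈ symmInterval α)
    (hh : |h| ≤ δ) (hk : |k| ≤ δ) (hh0 : h ≠ 0) (hk0 : k ≠ 0) :
    (h⁻¹ * (f (x + h) - f x) - k⁻¹ * (f (x + k) - f x)) ^ 2 ≤
      ((h ^ 2 / δ)⁻¹ * (f (β + h ^ 2 / δ) - f β) + (k ^ 2 / δ)⁻¹ * (f (β + k ^ 2 / δ) - f β) -
        2 * ((h * k / δ)⁻¹ * (f (β + h * k / δ) - f β))) * (δ⁻¹ * (f (β + δ) - f β)) := by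
  have hβ0 : 0 ≤ β := (abs_nonneg x).trans hxβ
  have hmem : ∀ y t : ℝ, |y| ≤ β → |t| ≤ δ → y + t ∈ symmInterval α := fun y t hy ht => by
    refine mem_symmInterval_of_abs_le hβ ((abs_add_le y t).trans ?_)
    rw [abs_of_nonneg (by positivity : 0 ≤ β + δ)]
    exact add_le_add hy ht
  have hmul : ∀ s t : ℝ, |s| ≤ δ → |t| ≤ δ → |s * t / δ| ≤ δ := fun s t hs ht => by
    rw [abs_div, abs_mul, abs_of_pos hδ, div_le_iff₀ hδ]
    exact mul_le_mul hs ht (abs_nonneg _) hδ.le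
  have hhh : |h ^ 2 / δ| ≤ δ := by rw [sq]; exact hmul h h hh hh
  have hkk : |k ^ 2 / δ| ≤ δ := by rw [sq]; exact hmul k k hk hk
  have hhk := hmul h k hh hk
  have h0 : |(0 : ℝ)| ≤ δ := by simpa using hδ.le
  have hββ : |β| ≤ β := (abs_of_nonneg hβ0).le
  have hδδ : |δ| ≤ δ := (abs_of_pos hδ).le
  -- C is wwᵀ/δ with w = (h, k, δ). In f[B + C] - f[B] the increments at x occupy only the last row
  -- and column off the diagonal; all others are increments at β.
  let B : Matrix (Fin 3) (Fin 3) ℝ := !![β, β, x; β, β, x; x, x, β]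
  let C : Matrix (Fin 3) (Fin 3) ℝ :=
    !![h ^ 2 / δ, h * k / δ, h; h * k / δ, k ^ 2 / δ, k; h, k, δ]
  have hB : B.PosSemidef := by
    refine Matrix.posSemidef_of_sum_nonneg (fun i j => by fin_cases i <;> fin_cases j <;> rfl)
      fun v => ?_
    simp only [Fin.sum_univ_three, B, Matrix.of_apply, Matrix.cons_val_zero, Matrix.cons_val_one,
      Matrix.cons_val]
    obtain ⟨h1, h2⟩ := abs_le.mp hxβ
    nlinarith [mul_nonneg (by linarith : 0 ≤ β + x) (sq_nonneg (v 0 + v 1 + v 2)),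
      mul_nonneg (by linarith : 0 ≤ β - x) (sq_nonneg (v 0 + v 1 - v 2))]
  have hC : C.PosSemidef := by
    refine Matrix.posSemidef_of_sum_nonneg (fun i j => by fin_cases i <;> fin_cases j <;> rfl)
      fun v => ?_
    simp only [Fin.sum_univ_three, C, Matrix.of_apply, Matrix.cons_val_zero, Matrix.cons_val_one,
      Matrix.cons_val]
    have : 0 ≤ (v 0 * h + v 1 * k + v 2 * δ) ^ 2 / δ := by positivity
    refine this.trans (le_of_eq ?_)
    field_simp
  have hM := hf (B + C) B
    (fun i j => by fin_cases i <;> fin_cases j <;> exact hmem _ _ (by assumption) (by assumption))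
    (fun i j => by
      rw [← add_zero (B i j)]
      fin_cases i <;> fin_cases j <;> exact hmem _ _ (by assumption) h0)
    (by simpa using hC) hB
  have key := hM.sq_sub_le h⁻¹ k⁻¹
  simp only [B, C, Matrix.sub_apply, Matrix.map_apply, Matrix.add_apply, Matrix.of_apply,
    Matrix.cons_val_zero, Matrix.cons_val_one, Matrix.cons_val] at key
  refine key.trans (le_of_eq ?_)
  field_simp

theorem SMonotone.differentiableAt {n : ℕ} (hn : 3 ≤ n) {α : EReal} {f : ℝ → ℝ}
    (hf : SMonotone n α f) {x : ℝ} (hx : x ∈ symmInterval α) : DifferentiableAt ℝ f x := by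
  obtain ⟨β, hxβ, hβ, hd⟩ := hf.exists_differentiableAt (by omega) hx
  have hβ0 : 0 < β := (abs_nonneg x).trans_lt hxβ
  have hf3 := hf.of_le (m := 3) (by norm_num) hn
  set L := deriv f β
  have hL := hasDerivAt_iff_tendsto_slope_zero.mp hd.hasDerivAt
  simp only [smul_eq_mul] at hL
  have hcau : Cauchy (Filter.map (fun t => t⁻¹ * (f (x + t) - f x)) (nhdsWithin 0 {0}ᶜ)) := by
    rw [Metric.cauchy_iff]
    refine ⟨inferInstance, fun ε hε => ?_⟩
    -- If the quotients at β are within ρ of L, the combination 1 + 1 - 2 cancels L and leaves at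
    -- most 4ρ; the other factor is at most |L| + 1.
    obtain ⟨ρ, hρ, hρ1, hρε⟩ : ∃ ρ : ℝ, 0 < ρ ∧ ρ ≤ 1 ∧ 4 * ρ * (|L| + 1) < ε ^ 2 := by
      have hpos : 0 < 8 * (|L| + 1) := by positivity
      refine ⟨min 1 (ε ^ 2 / (8 * (|L| + 1))), by positivity, min_le_left _ _, ?_⟩
      have h1 := (le_div_iff₀ hpos).mp (min_le_right 1 (ε ^ 2 / (8 * (|L| + 1))))
      nlinarith [sq_pos_of_pos hε]
    have hev : ∀ᶠ t in nhdsWithin 0 {0}ᶜ, |t⁻¹ * (f (β + t) - f β) - L| < ρ := by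
      have := Metric.tendsto_nhds.mp hL ρ hρ
      simpa only [Real.dist_eq] using this
    obtain ⟨η, hη, hball⟩ := Metric.eventually_nhds_iff.mp (eventually_nhdsWithin_iff.mp hev)
    obtain ⟨c, hc, hcα⟩ := exists_abs_lt_mem_symmInterval hβ
    rw [abs_of_pos hβ0] at hc
    -- Half of η gives the strict bound δ < η; c - β keeps β + δ in the interval.
    set δ := min (η / 2) (c - β)
    have hδ : 0 < δ := lt_min (by linarith) (by linarith)
    have hδη : δ < η := (min_le_left _ _).trans_lt (by linarith)
    have hQ : ∀ t, t ≠ 0 → |t| ≤ δ → |t⁻¹ * (f (β + t) - f β) - L| < ρ := fun t ht h =>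
      hball (by rw [Real.dist_eq, sub_zero]; linarith) ht
    have hβδ : β + δ ∈ symmInterval α := by
      refine mem_symmInterval_of_abs_le hcα ?_
      rw [abs_of_pos (by linarith), abs_of_pos (by linarith)]
      linarith [min_le_right (η / 2) (c - β)]
    have hmul : ∀ s t : ℝ, |s| ≤ δ → |t| ≤ δ → |s * t / δ| ≤ δ := fun s t hs ht => by
      rw [abs_div, abs_mul, abs_of_pos hδ, div_le_iff₀ hδ]
      exact mul_le_mul hs ht (abs_nonneg _) hδ.le
    refine ⟨(fun t => t⁻¹ * (f (x + t) - f x)) '' (Metric.ball 0 δ ∩ {0}ᶜ),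
      Filter.image_mem_map (Filter.inter_mem
        (nhdsWithin_le_nhds (Metric.ball_mem_nhds _ hδ)) self_mem_nhdsWithin), ?_⟩
    rintro _ ⟨h, ⟨hh, hh0⟩, rfl⟩ _ ⟨k, ⟨hk, hk0⟩, rfl⟩
    rw [Metric.mem_ball, Real.dist_eq, sub_zero] at hh hk
    have hh0' : h ≠ 0 := hh0
    have hk0' : k ≠ 0 := hk0
    have key := hf3.sq_slope_sub_slope_le hxβ.le hδ hβδ hh.le hk.le hh0' hk0'
    have q1 := abs_lt.mp (hQ (h ^ 2 / δ) (by positivity) (by rw [sq]; exact hmul h h hh.le hh.le))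
    have q2 := abs_lt.mp (hQ (k ^ 2 / δ) (by positivity) (by rw [sq]; exact hmul k k hk.le hk.le))
    have q3 := abs_lt.mp (hQ (h * k / δ) (by positivity) (hmul h k hh.le hk.le))
    have q4 := abs_lt.mp (hQ δ hδ.ne' (abs_of_pos hδ).le)
    have hnonneg : 0 ≤ δ⁻¹ * (f (β + δ) - f β) := by
      refine mul_nonneg (by positivity) (sub_nonneg.mpr ?_)
      exact hf.monotoneOn (by omega) ⟨hβ, hβ0.le⟩ ⟨hβδ, (by positivity : 0 ≤ β + δ)⟩ (by linarith)
    rw [Real.dist_eq]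
    refine abs_lt_of_sq_lt_sq ?_ hε.le
    refine lt_of_le_of_lt key (lt_of_le_of_lt ?_ hρε)
    refine mul_le_mul ?_ ?_ hnonneg (by positivity)
    · linarith [q1.1, q1.2, q2.1, q2.2, q3.1, q3.2]
    · linarith [q4.2, le_abs_self L]
  obtain ⟨l, hl⟩ := cauchy_iff_exists_le_nhds.mp hcau
  exact (hasDerivAt_iff_tendsto_slope_zero.mpr (by simpa only [smul_eq_mul] using! hl) :
    HasDerivAt f l x).differentiableAt

/-! ### Positivity of the divided difference matrix and conclusion. -/

/-- The entrywise derivative of an S-monotone function preserves positive semidefiniteness. -/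
theorem SMonotone.posSemidef_map_deriv {n : ℕ} (hn : 3 ≤ n) {α : EReal} {f : ℝ → ℝ}
    (hf : SMonotone n α f) {A : Matrix (Fin n) (Fin n) ℝ} (hA : A.PosSemidef)
    (hAα : ∀ i j, A i j ∈ symmInterval α) : (A.map (deriv f)).PosSemidef := by
  refine Matrix.posSemidef_of_sum_nonneg
    (fun i j => by rw [Matrix.map_apply, Matrix.map_apply, hA.apply_comm]) fun v => ?_
  have hlim : Filter.Tendsto
      (fun t : ℝ => ∑ i, ∑ j, v i * v j * (t⁻¹ * (f (A i j + t) - f (A i j))))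
      (nhdsWithin 0 (Set.Ioi 0)) (nhds (∑ i, ∑ j, v i * v j * A.map (deriv f) i j)) := by
    refine tendsto_finsetSum _ fun i _ => tendsto_finsetSum _ fun j _ =>
      Filter.Tendsto.const_mul _ ?_
    have h := hasDerivAt_iff_tendsto_slope_zero.mp (hf.differentiableAt hn (hAα i j)).hasDerivAt
    exact h.mono_left (nhdsWithin_mono _ fun t ht => (ne_of_gt ht : t ≠ 0))
  have hmem : ∀ᶠ t : ℝ in nhdsWithin 0 (Set.Ioi 0), ∀ i j, A i j + t ∈ symmInterval α := by
    simp only [Filter.eventually_all]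
    intro i j
    refine nhdsWithin_le_nhds ?_
    have hc : ContinuousAt (fun t : ℝ => A i j + t) 0 := by fun_prop
    exact hc.preimage_mem_nhds ((isOpen_symmInterval α).mem_nhds (by simpa using hAα i j))
  refine ge_of_tendsto hlim ?_
  filter_upwards [hmem, self_mem_nhdsWithin] with t ht ht0
  have ht0' : 0 < t := ht0
  have h := (hf (A + .of fun _ _ => t) A ht hAα
    (by simpa using Matrix.posSemidef_const ht0'.le) hA).sum_nonneg v
  have e : ∑ i, ∑ j, v i * v j * (t⁻¹ * (f (A i j + t) - f (A i j))) =
      t⁻¹ * ∑ i, ∑ j, v i * v j * (f (A i j + t) - f (A i j)) := by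
    simp only [Finset.mul_sum]
    exact Finset.sum_congr rfl fun i _ => Finset.sum_congr rfl fun j _ => by ring
  rw [e]
  exact mul_nonneg (by positivity) h

theorem dividedDifference_mul_sub (f : ℝ → ℝ) (a b : ℝ) :
    dividedDifference f a b * (a - b) = f a - f b := by
  unfold dividedDifference
  by_cases h : a = b
  · simp [h]
  · rw [if_neg h, div_mul_cancel₀ _ (sub_ne_zero.mpr h)]

/-- An explicit primitive avoids having to show that f' is integrable. -/
theorem exists_primitive_along_segment {s : Set ℝ} (hs : Convex ℝ s) {f : ℝ → ℝ}
    (hf : ∀ x ∈ s, DifferentiableAt ℝ f x) {a b : ℝ} (ha : a ∈ s) (hb : b ∈ s) :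
    ∃ g : ℝ → ℝ, (∀ t ∈ Set.Icc (0 : ℝ) 1, HasDerivAt g (deriv f (b + t * (a - b))) t) ∧
      g 1 - g 0 = dividedDifference f a b := by
  by_cases h : a = b
  · subst h
    refine ⟨fun t => deriv f a * t, fun t _ => ?_, by simp [dividedDifference]⟩
    simpa using (hasDerivAt_id t).const_mul (deriv f a)
  · have hab : a - b ≠ 0 := sub_ne_zero.mpr h
    refine ⟨fun t => f (b + t * (a - b)) / (a - b), fun t ht => ?_, ?_⟩
    · have hmem : b + t * (a - b) ∈ s := by
        have := hs hb ha (sub_nonneg.mpr ht.2) ht.1 (by ring)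
        simp only [smul_eq_mul] at this
        convert this using 1
        ring
      have h1 : HasDerivAt (fun t : ℝ => b + t * (a - b)) (a - b) t := by
        simpa using ((hasDerivAt_id t).mul_const (a - b)).const_add b
      have h2 := ((hf _ hmem).hasDerivAt.comp t h1).div_const (a - b)
      rwa [mul_div_cancel_right₀ _ hab] at h2
    · simp [dividedDifference, h, sub_div]

/-- For fixed v, the quadratic form is the increment over [0,1] of a function whose derivative is
the form of f'[(1-t)B + tA], hence nonnegative. -/
theorem SMonotone.posSemidef_dividedDifference {n : ℕ} (hn : 3 ≤ n) {α : EReal} {f : ℝ → ℝ}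
    (hf : SMonotone n α f) {A B : Matrix (Fin n) (Fin n) ℝ} (hA : A.PosSemidef)
    (hB : B.PosSemidef) (hAα : ∀ i j, A i j ∈ symmInterval α)
    (hBα : ∀ i j, B i j ∈ symmInterval α) :
    (Matrix.of fun i j => dividedDifference f (A i j) (B i j)).PosSemidef := by
  refine Matrix.posSemidef_of_sum_nonneg
    (fun i j => by rw [Matrix.of_apply, Matrix.of_apply, hA.apply_comm, hB.apply_comm]) fun v => ?_
  choose g hg hg1 using fun i j => exists_primitive_along_segment (convex_symmInterval α)
    (fun x hx => hf.differentiableAt hn hx) (hAα i j) (hBα i j)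
  have hder : ∀ t ∈ Set.Icc (0 : ℝ) 1, HasDerivAt (fun t => ∑ i, ∑ j, v i * v j * g i j t)
      (∑ i, ∑ j, v i * v j * deriv f (B i j + t * (A i j - B i j))) t := fun t ht =>
    .fun_sum fun i _ => .fun_sum fun j _ => (hg i j t ht).const_mul _
  have hmono : MonotoneOn (fun t => ∑ i, ∑ j, v i * v j * g i j t) (Set.Icc 0 1) := by
    refine monotoneOn_of_deriv_nonneg (convex_Icc 0 1)
      (fun t ht => (hder t ht).continuousAt.continuousWithinAt)
      (fun t ht => (hder t (interior_subset ht)).differentiableAt.differentiableWithinAt)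
      fun t ht => ?_
    replace ht := interior_subset ht
    rw [(hder t ht).deriv]
    have hS : ((1 - t) • B + t • A).PosSemidef :=
      (hB.smul (sub_nonneg.mpr ht.2)).add (hA.smul ht.1)
    have hSα : ∀ i j, ((1 - t) • B + t • A) i j ∈ symmInterval α := fun i j =>
      convex_symmInterval α (hBα i j) (hAα i j) (sub_nonneg.mpr ht.2) ht.1 (by ring)
    refine ((hf.posSemidef_map_deriv hn hS hSα).sum_nonneg v).trans (le_of_eq ?_)
    refine Finset.sum_congr rfl fun i _ => Finset.sum_congr rfl fun j _ => ?_
    simp only [Matrix.map_apply, Matrix.add_apply, Matrix.smul_apply, smul_eq_mul]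
    congr 2
    ring
  have h01 := hmono (Set.left_mem_Icc.mpr zero_le_one) (Set.right_mem_Icc.mpr zero_le_one)
    zero_le_one
  have e : ∑ i, ∑ j, v i * v j * (Matrix.of fun i j => dividedDifference f (A i j) (B i j)) i j =
      ∑ i, ∑ j, v i * v j * g i j 1 - ∑ i, ∑ j, v i * v j * g i j 0 := by
    simp only [Matrix.of_apply, ← hg1, mul_sub, Finset.sum_sub_distrib]
  rw [e]
  exact sub_nonneg.mpr h01

theorem proposition6p6 (n : ℕ) (hn : 3 ≤ n) (α : EReal) (hα : 0 < α) (f : ℝ → ℝ)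
    (hf : SMonotone n α f) :
    DifferentiableOn ℝ f (symmInterval α) ∧
    ∀ A B : Matrix (Fin n) (Fin n) ℝ, A.PosSemidef → B.PosSemidef →
      (∀ i j, A i j ∈ symmInterval α) → (∀ i j, B i j ∈ symmInterval α) →
      WeakMajorized (singVals (A.map f - B.map f))
        (fun k => (⨆ i : Fin n, dividedDifference f (A i i) (B i i)) * singVals (A - B) k) := by
  refine ⟨fun x hx => (hf.differentiableAt hn hx).differentiableWithinAt,
    fun A B hA hB hAα hBα k => ?_⟩
  have hP := hf.posSemidef_dividedDifference hn hA hB hAα hBα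
  have hdiag : ∀ i, dividedDifference f (A i i) (B i i) ≤
      ⨆ i : Fin n, dividedDifference f (A i i) (B i i) := le_ciSup (Set.finite_range _).bddAbove
  have hm0 : 0 ≤ ⨆ i : Fin n, dividedDifference f (A i i) (B i i) :=
    Real.iSup_nonneg fun i => hP.diag_nonneg (i := i)
  have hhad : A.map f - B.map f =
      (Matrix.of fun i j => dividedDifference f (A i j) (B i j)).hadamard (A - B) := by
    ext i j
    exact (dividedDifference_mul_sub f (A i j) (B i j)).symm
  -- Both vectors are already decreasing, the second because its factor is nonnegative.
  rw [decreasingRearrangement_of_antitone (singVals_antitone _),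
    decreasingRearrangement_of_antitone ((singVals_antitone (A - B)).const_mul hm0),
    ← Finset.mul_sum, hhad]
  exact sum_singVals_hadamard_le hP (A - B) hm0 hdiag k
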